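/- Let $\mathcal F$ be a finite signature, $\mathcal V$ a denumerable set of variables, and let $\mathcal R$ be a finite linear term rewriting system over $\mathcal F$: a finite set of rules $l\to r$ with $l,r\in\mathcal T(\mathcal F,\mathcal V)$, $\mathrm{Var}(r)\subseteq \mathrm{Var}(l)$, and every variable occurring at most once in $l$ and at most once in $r$ (the left-hand side $l$ may be a variable). Let $T\subseteq\mathcal T(\mathcal F)$ be a set of ground terms recognized by a finite (nondeterministic, bottom-up) tree automaton, and let $k\ge 0$ be an integer. Then the set of ancestors $$({}_k\!\!\to^*_{\mathcal R})[T]=\{\,s\in\mathcal T(\mathcal F)\mid \exists t\in T,\ s\ {}_k\!\!\to^*_{\mathcal R}\ t\,\}$$ is also recognized by a finite tree automaton. Here ${}_k\!\!\to^*_{\mathcal R}$ denotes bottom-up($k$) rewriting, defined as follows. Marked terms are terms over the symbols $f^i$ ($f\in\mathcal F$, $i\in\mathbb N$); $f$ is identified with $f^0$, the mark $m(\bar t)$ of a marked term is the mark of its root (and $0$ for a variable), and $\bar t\odot n$ is obtained from $\bar t$ by replacing each mark $i$ by $\max(i,n)$. There is a marked rewriting step $\bar s\circ\!\!\to\bar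 t$ if $\bar s=\bar C[\bar l\bar\sigma]$ and $\bar t=\bar C[r\sigma']$, where $l\to r\in\mathcal R$, $\bar l$ is a marked version of $l$ (its variables carry no mark), $r$ carries only null marks, $\bar C$ is a marked ground context and $\bar\sigma$ a marked ground substitution, and $x\sigma'=x\bar\sigma\odot M(\bar C[\bar l],x)$, where $M(\bar C[\bar l],x)$ is $1$ plus the greatest mark of a node of $\bar C[\bar l]$ strictly above the occurrence of $x$ (the greatest mark being $0$ if there is no such node). The step is weakly bottom-up if $m(\bar l)=0$ when $l\notin\mathcal V$, and if all nodes of $\bar C$ strictly above the position of rewriting have mark $0$ when $l\in\mathcal V$. Finally $s\ {}_k\!\!\to^*_{\mathcal R}\ t$ means that there is a marked derivation, starting from $s$ with all its marks equal to $0$ and ending in a term whose underlying unmarked term is $t$, all of whose steps are weakly bottom-up and all of whose marks are $\le k$. -/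

import Mathlib

universe u v

namespace BottomUp

/- A signature is given by the function symbols of a first-order language `L` (relation symbols,
if any, play no role).  `L.Term ℕ` is the set of terms over the denumerable set `ℕ` of variables,
`L.Term Empty` is the set of ground terms. -/

/-- Number of occurrences of the variable `x` in a term. -/
def occ {L : FirstOrder.Language.{u, v}} (x : ℕ) : L.Term ℕ → ℕ
  | .var y => if y = x then 1 else 0
  | .func _ ts => ∑ j, occ x (ts j)

/-- A term is linear if every variable occurs at most once in it. -/
def LinearTerm {L : FirstOrder.Language.{u, v}} (t : L.Term ℕ) : Prop :=
  ∀ x, occ x t ≤ 1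

/-- A rewrite rule `lhs → rhs`; the left-hand side is allowed to be a variable. -/
structure Rule (L : FirstOrder.Language.{u, v}) where
  lhs : L.Term ℕ
  rhs : L.Term ℕ
  vars_subset : rhs.varFinset ⊆ lhs.varFinset

/-- A rewriting system is linear if both sides of each of its rules are linear. -/
def LinearSystem {L : FirstOrder.Language.{u, v}} (R : Set (Rule L)) : Prop :=
  ∀ ρ ∈ R, LinearTerm ρ.lhs ∧ LinearTerm ρ.rhs

/-- A ground one-hole context.  In `func f i ts C` the hole is in the `i`-th argument of `f`, the
other arguments are the `ts j`, `j ≠ i` (the entry `ts i` is not used). -/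
inductive Ctx (L : FirstOrder.Language.{u, v}) : Type u
  | hole : Ctx L
  | func {n : ℕ} (f : L.Functions n) (i : Fin n) (ts : Fin n → L.Term Empty) (C : Ctx L) : Ctx L

/-- The ground term `C[t]`. -/
def Ctx.fill {L : FirstOrder.Language.{u, v}} : Ctx L → L.Term Empty → L.Term Empty
  | .hole, t => t
  | .func f i ts C, t => .func f (Function.update ts i (C.fill t))

/-! ### Marked terms -/

/-- The signature of marked symbols `f^i`, for `f` a symbol and `i` a natural number. -/
def marked (L : FirstOrder.Language.{u, v}) : FirstOrder.Language.{u, v} :=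
  ⟨fun n => L.Functions n × ℕ, L.Relations⟩

/-- The mark `i` of a marked symbol `f^i`. -/
def symMark {L : FirstOrder.Language.{u, v}} {n : ℕ} (f : (marked L).Functions n) : ℕ :=
  Prod.snd f

/-- The symbol morphism `f^i ↦ f`. -/
def eraseHom (L : FirstOrder.Language.{u, v}) : FirstOrder.Language.LHom (marked L) L where
  onFunction := fun _ f => Prod.fst f
  onRelation := fun _ r => r

/-- The symbol morphism `f ↦ f^0`. -/
def zeroHom (L : FirstOrder.Language.{u, v}) : FirstOrder.Language.LHom L (marked L) where
  onFunction := fun _ f => (f, 0)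
  onRelation := fun _ r => r

/-- The underlying unmarked term of a marked term. -/
def erase {L : FirstOrder.Language.{u, v}} {α : Type} (t : (marked L).Term α) : L.Term α :=
  (eraseHom L).onTerm t

/-- An unmarked term, seen as a marked term all of whose marks are `0`. -/
def unmarked {L : FirstOrder.Language.{u, v}} {α : Type} (t : L.Term α) : (marked L).Term α :=
  (zeroHom L).onTerm t

/-- The mark of the root of a marked term (`0` for a variable). -/
def rootMark {L : FirstOrder.Language.{u, v}} {α : Type} : (marked L).Term α → ℕ
  | .var _ => 0
  | .func f _ => symMark f

/-- The greatest mark in a marked term. -/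
def maxMark {L : FirstOrder.Language.{u, v}} {α : Type} : (marked L).Term α → ℕ
  | .var _ => 0
  | .func f ts => max (symMark f) (Finset.univ.sup fun j => maxMark (ts j))

/-- The marked term `t ⊙ n`: every mark `i` of `t` is replaced by `max i n`. -/
def raise {L : FirstOrder.Language.{u, v}} {α : Type} (n : ℕ) : (marked L).Term α → (marked L).Term α
  | .var x => .var x
  | .func f ts => .func (L := marked L) (Prod.fst f, max (symMark f) n) fun j => raise n (ts j)

/-- The greatest mark of a node of the marked context `C` that is a strict ancestor of the hole
(`0` if there is none). -/
def Ctx.markAbove {L : FirstOrder.Language.{u, v}} : Ctx (marked L) → ℕ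
  | .hole => 0
  | .func f _ _ C => max (symMark f) C.markAbove

/-- The greatest mark of a node of the marked term `t` that is a strict ancestor of an occurrence
of the variable `x` (`0` if there is none). -/
def varMarkAbove {L : FirstOrder.Language.{u, v}} (x : ℕ) : (marked L).Term ℕ → ℕ
  | .var _ => 0
  | .func f ts =>
    if ∃ j, x ∈ (ts j).varFinset then
      max (symMark f) (Finset.univ.sup fun j => varMarkAbove x (ts j))
    else 0

/-- The integer `M(C[l], x)`: one plus the greatest mark of a strict ancestor of `x` in `C[l]`. -/
def nextMark {L : FirstOrder.Language.{u, v}} (C : Ctx (marked L)) (l : (marked L).Term ℕ) (x : ℕ) : ℕ :=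
  max C.markAbove (varMarkAbove x l) + 1

/-! ### Bottom-up rewriting -/

/-- `MarkedStep ρ C l s t`: there is a one-step marked rewriting from `s` to `t` that applies the
rule `ρ` in the marked context `C`, on a marked version `l` of the left-hand side of `ρ`, i.e.
`s = C[l σ]` and `t = C[r σ']` with `x σ' = (x σ) ⊙ M(C[l], x)` for every variable `x`. -/
def MarkedStep {L : FirstOrder.Language.{u, v}} (ρ : Rule L) (C : Ctx (marked L)) (l : (marked L).Term ℕ)
    (s t : (marked L).Term Empty) : Prop :=
  erase l = ρ.lhs ∧
    ∃ σ : ℕ → (marked L).Term Empty,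
      s = C.fill (l.subst σ) ∧
        t = C.fill ((unmarked ρ.rhs).subst fun x => raise (nextMark C l x) (σ x))

/-- The condition for a marked step to be weakly bottom-up: the root of the marked left-hand side
has mark `0` or, when the left-hand side is a variable, all the nodes strictly above the position
of the rewriting have mark `0`. -/
def WeaklyBottomUp {L : FirstOrder.Language.{u, v}} (ρ : Rule L) (C : Ctx (marked L))
    (l : (marked L).Term ℕ) : Prop :=
  ((¬ ∃ x, ρ.lhs = .var x) → rootMark l = 0) ∧ ((∃ x, ρ.lhs = .var x) → C.markAbove = 0)

/-- A weakly bottom-up marked step of `R` between marked terms all of whose marks are `≤ k`. -/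
def BUStep {L : FirstOrder.Language.{u, v}} (R : Set (Rule L)) (k : ℕ) (s t : (marked L).Term Empty) : Prop :=
  maxMark s ≤ k ∧ maxMark t ≤ k ∧
    ∃ ρ ∈ R, ∃ C l, MarkedStep ρ C l s t ∧ WeaklyBottomUp ρ C l

/-- There is a `bu(k)`-derivation of `R` from `s` to `t`: a derivation whose corresponding marked
derivation, starting on `s` with null marks, is weakly bottom-up and has all its marks `≤ k`. -/
def BURewrites {L : FirstOrder.Language.{u, v}} (R : Set (Rule L)) (k : ℕ) (s t : L.Term Empty) : Prop :=
  ∃ t' : (marked L).Term Empty, Relation.ReflTransGen (BUStep R k) (unmarked s) t' ∧ erase t' = t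

/-- The set of ancestors of `T` under `bu(k)`-derivations of `R`. -/
def buAncestors {L : FirstOrder.Language.{u, v}} (R : Set (Rule L)) (k : ℕ) (T : Set (L.Term Empty)) :
    Set (L.Term Empty) :=
  {s | ∃ t ∈ T, BURewrites R k s t}

/-! ### Recognizable sets of ground terms -/

/-- A (nondeterministic, bottom-up) tree automaton with set of states `Q`: a set of final states,
and a set of transitions `f(q₁, …, qₙ) → q`, given by `q ∈ trans f (q₁, …, qₙ)`. -/
structure TreeAutomaton (L : FirstOrder.Language.{u, v}) (Q : Type) where
  trans : ∀ {n : ℕ}, L.Functions n → (Fin n → Q) → Set Q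
  final : Set Q

/-- The set of states to which the automaton can reduce a ground term. -/
def TreeAutomaton.states {L : FirstOrder.Language.{u, v}} {Q : Type} (A : TreeAutomaton L Q) :
    L.Term Empty → Set Q
  | .var x => x.elim
  | .func f ts => {q | ∃ p : Fin _ → Q, (∀ i, p i ∈ A.states (ts i)) ∧ q ∈ A.trans f p}

/-- The language recognized by a tree automaton. -/
def TreeAutomaton.language {L : FirstOrder.Language.{u, v}} {Q : Type} (A : TreeAutomaton L Q) :
    Set (L.Term Empty) :=
  {t | ∃ q ∈ A.final, q ∈ A.states t}

/-- A set of ground terms is recognizable if it is the language of a finite tree automaton. -/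
def Recognizable {L : FirstOrder.Language.{u, v}} (T : Set (L.Term Empty)) : Prop :=
  ∃ (Q : Type) (_ : Finite Q) (A : TreeAutomaton L Q), A.language = T

end BottomUp

/-!
The proof replaces bottom-up rewriting by rewriting with finitely many redexes on *truncated* terms.

Along a derivation that starts with null marks, marks increase from the root to the leaves, so every
step takes place below null marks (`WeaklyBottomUp.markAbove_eq_zero`). Hence a subterm whose root
has a positive mark is only ever touched from above: a left-hand side consumes at most `d` symbols
on each of its branches, where `d` bounds the heights of the left-hand sides, and gives what remains
a greater mark. With marks at most `k`, only a part of bounded height of such a subterm is ever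
used; what lies below is erased or survives in the final term, so it may be replaced as soon as it
gets a positive mark by a state of a complete automaton `A` that recognizes `T`.

This gives a system `TruncStep` on marked terms whose leaves are states of `A`. It applies, below
null marks, the transitions of `A` and the marked rewriting steps of `R`, to redexes of bounded
height and marks, of which there are finitely many. A derivation of this system lifts to a
derivation of `R` (`Trunc.lift_star`, where left-linearity is used). Conversely, a derivation of `R`
to a term that `A` reduces to `q` projects to a truncated derivation to `q`
(`Adm.exists_star_of_derivation`, by induction from the end of the derivation, where
right-linearity is used). The bound on the truncations is the predicate `Fit`.

Finally, reachability for a system with finitely many redexes is recognizable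
(`recognizable_of_finite_redexes`): the states are the bounded terms `w`, and `f(w₁, …, wₙ) → w` is
a transition when `w` can be reached from `f(w₁, …, wₙ)`. Considering the first rewriting at the
root of a derivation shows that this automaton is complete for reachability.
-/

namespace BottomUp

open FirstOrder FirstOrder.Language Relation

variable {L : FirstOrder.Language.{u, v}} {α Q : Type}

/-! ### Terms, marks and substitutions -/

/-- The height of a term; variables have height `0`. -/
def height : L.Term α → ℕ
  | .var _ => 0
  | .func _ ts => (Finset.univ.sup fun j => height (ts j)) + 1

/-- The symbol `f` with mark `0`. -/
def nullMark {n : ℕ} (f : L.Functions n) : (marked L).Functions n := (f, 0)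

theorem erase_func {n : ℕ} (f : (marked L).Functions n) (ts : Fin n → (marked L).Term α) :
    erase (.func f ts) = .func (Prod.fst f) fun i => erase (ts i) := rfl

theorem unmarked_func {n : ℕ} (f : L.Functions n) (ts : Fin n → L.Term α) :
    unmarked (.func f ts) = .func (nullMark f) fun i => unmarked (ts i) := rfl

theorem unmarked_var (x : α) : unmarked (.var x : L.Term α) = .var x := rfl

theorem erase_unmarked (t : L.Term α) : erase (unmarked t) = t := by
  induction t with
  | var x => rfl
  | func f ts ih =>
    rw [unmarked_func, erase_func]
    exact congrArg (Term.func f) (funext ih)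

theorem varFinset_erase (t : (marked L).Term ℕ) : (erase t).varFinset = t.varFinset := by
  induction t with
  | var x => rfl
  | func f ts ih => simp only [erase_func, Term.varFinset, ih]

theorem varFinset_unmarked (t : L.Term ℕ) : (unmarked t).varFinset = t.varFinset := by
  rw [← varFinset_erase, erase_unmarked]

theorem occ_erase (x : ℕ) (t : (marked L).Term ℕ) : occ x (erase t) = occ x t := by
  induction t with
  | var y => rfl
  | func f ts ih => simp only [erase_func, occ, ih]

theorem height_erase (t : (marked L).Term α) : height (erase t) = height t := by
  induction t with
  | var y => rfl
  | func f ts ih => simp only [erase_func, height, ih]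

theorem linearTerm_of_erase {t : (marked L).Term ℕ} (h : LinearTerm (erase t)) : LinearTerm t :=
  fun x => occ_erase x t ▸ h x

theorem linearTerm_unmarked {t : L.Term ℕ} (h : LinearTerm t) : LinearTerm (unmarked t) :=
  linearTerm_of_erase ((erase_unmarked t).symm ▸ h)

/-- The symbol `f ⊙ m`, whose mark is `max (symMark f) m`. -/
def raiseSym {n : ℕ} (m : ℕ) (f : (marked L).Functions n) : (marked L).Functions n :=
  (Prod.fst f, max (symMark f) m)

theorem raise_func {n : ℕ} (m : ℕ) (f : (marked L).Functions n)
    (ts : Fin n → (marked L).Term α) :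
    raise m (.func f ts) = .func (raiseSym m f) fun i => raise m (ts i) := rfl

theorem symMark_raiseSym {n : ℕ} (m : ℕ) (f : (marked L).Functions n) :
    symMark (raiseSym m f) = max (symMark f) m := rfl

theorem erase_raise (n : ℕ) (t : (marked L).Term α) : erase (raise n t) = erase t := by
  induction t with
  | var y => rfl
  | func f ts ih =>
    rw [raise_func, erase_func, erase_func]
    exact congrArg (Term.func _) (funext ih)

theorem maxMark_le_func {k n : ℕ} {f : (marked L).Functions n} {ts : Fin n → (marked L).Term α} :
    maxMark (.func f ts) ≤ k ↔ symMark f ≤ k ∧ ∀ i, maxMark (ts i) ≤ k := by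
  simp [maxMark]

theorem maxMark_unmarked (t : L.Term α) : maxMark (unmarked t) = 0 := by
  induction t with
  | var x => rfl
  | func f ts ih =>
    rw [unmarked_func, ← Nat.le_zero, maxMark_le_func]
    exact ⟨le_rfl, fun i => (ih i).le⟩

theorem maxMark_raise_le {k n : ℕ} (hn : n ≤ k) {t : (marked L).Term α} (ht : maxMark t ≤ k) :
    maxMark (raise n t) ≤ k := by
  induction t with
  | var x => exact Nat.zero_le _
  | func f ts ih =>
    rw [maxMark_le_func] at ht
    rw [raise_func, maxMark_le_func]
    exact ⟨max_le ht.1 hn, fun i => ih i (ht.2 i)⟩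

/-- A ground term has a root symbol, so raising its marks to `n` produces a root mark `≥ n`. -/
theorem le_rootMark_raise (n : ℕ) (t : (marked L).Term Empty) : n ≤ rootMark (raise n t) := by
  cases t with
  | var x => exact x.elim
  | func f ts => exact le_max_right _ _

theorem rootMark_le_maxMark (t : (marked L).Term α) : rootMark t ≤ maxMark t := by
  cases t with
  | var x => exact le_rfl
  | func f ts => exact le_max_left _ _

theorem mem_varFinset_func {M : FirstOrder.Language.{u, v}} {n : ℕ} {f : M.Functions n}
    {ts : Fin n → M.Term ℕ} {x : ℕ} :
    x ∈ (Term.func f ts).varFinset ↔ ∃ i, x ∈ (ts i).varFinset := by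
  simp [Term.varFinset]

theorem subst_congr {M : FirstOrder.Language.{u, v}} {t : M.Term ℕ} {σ τ : ℕ → M.Term α}
    (h : ∀ x ∈ t.varFinset, σ x = τ x) : t.subst σ = t.subst τ := by
  induction t with
  | var x => exact h x (by simp [Term.varFinset])
  | func f ts ih =>
    simp only [Term.subst]
    congr 1
    funext i
    exact ih i fun x hx => h x (mem_varFinset_func.2 ⟨i, hx⟩)

theorem occ_pos {M : FirstOrder.Language.{u, v}} {t : M.Term ℕ} {x : ℕ} (h : x ∈ t.varFinset) :
    0 < occ x t := by
  induction t with
  | var y =>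
    simp only [Term.varFinset, Finset.mem_singleton] at h
    simp [occ, h]
  | func f ts ih =>
    obtain ⟨i, hi⟩ := mem_varFinset_func.1 h
    exact (ih i hi).trans_le (Finset.single_le_sum (f := fun j => occ x (ts j))
      (fun _ _ => Nat.zero_le _) (Finset.mem_univ i))

theorem LinearTerm.arg {M : FirstOrder.Language.{u, v}} {n : ℕ} {f : M.Functions n}
    {ts : Fin n → M.Term ℕ} (h : LinearTerm (.func f ts)) (i : Fin n) : LinearTerm (ts i) :=
  fun x => (Finset.single_le_sum (f := fun j => occ x (ts j))
    (fun _ _ => Nat.zero_le _) (Finset.mem_univ i)).trans (h x)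

/-- In a linear term, distinct arguments have no common variable. -/
theorem LinearTerm.arg_unique {M : FirstOrder.Language.{u, v}} {n : ℕ} {f : M.Functions n}
    {ts : Fin n → M.Term ℕ} (h : LinearTerm (.func f ts)) {x : ℕ} {i j : Fin n}
    (hi : x ∈ (ts i).varFinset) (hj : x ∈ (ts j).varFinset) : i = j := by
  by_contra hij
  have h1 := occ_pos hi
  have h2 := occ_pos hj
  have h3 : occ x (ts i) + occ x (ts j) ≤ occ x (.func f ts) := by
    rw [← Finset.sum_pair (f := fun j => occ x (ts j)) hij]
    exact Finset.sum_le_sum_of_subset (Finset.subset_univ _)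
  have := h x
  omega

/-- Substitutions found separately for the arguments of a linear term can be glued together. -/
theorem LinearTerm.glue {M : FirstOrder.Language.{u, v}} {n : ℕ} {f : M.Functions n}
    {ts : Fin n → M.Term ℕ} (h : LinearTerm (.func f ts)) {us : Fin n → M.Term α}
    {P : ℕ → M.Term α → Prop}
    (hus : ∀ i, ∃ σ : ℕ → M.Term α, us i = (ts i).subst σ ∧ ∀ x ∈ (ts i).varFinset, P x (σ x))
    (σ₀ : ℕ → M.Term α) :
    ∃ σ : ℕ → M.Term α, Term.func f us = (Term.func f ts).subst σ ∧
      ∀ x ∈ (Term.func f ts).varFinset, P x (σ x) := by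
  classical
  choose σ hσ hP using hus
  let τ : ℕ → M.Term α := fun x =>
    if hx : ∃ i, x ∈ (ts i).varFinset then σ hx.choose x else σ₀ x
  have hτ : ∀ i, ∀ x ∈ (ts i).varFinset, σ i x = τ x := by
    intro i x hx
    have hex : ∃ i, x ∈ (ts i).varFinset := ⟨i, hx⟩
    simp only [τ, dif_pos hex]
    rw [h.arg_unique hx hex.choose_spec]
  refine ⟨τ, ?_, ?_⟩
  · simp only [Term.subst]
    congr 1
    funext i
    rw [hσ i]
    exact subst_congr (hτ i)
  · intro x hx
    obtain ⟨i, hi⟩ := mem_varFinset_func.1 hx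
    rw [← hτ i x hi]
    exact hP i x hi

theorem maxMark_le_of_subst {k : ℕ} {t : (marked L).Term ℕ} {σ : ℕ → (marked L).Term α}
    (h : maxMark (t.subst σ) ≤ k) {x : ℕ} (hx : x ∈ t.varFinset) : maxMark (σ x) ≤ k := by
  induction t with
  | var y =>
    simp only [Term.varFinset, Finset.mem_singleton] at hx
    exact hx ▸ h
  | func f ts ih =>
    obtain ⟨i, hi⟩ := mem_varFinset_func.1 hx
    exact ih i ((maxMark_le_func.1 h).2 i) hi

theorem maxMark_unmarked_subst_le {k : ℕ} {t : L.Term ℕ} {σ : ℕ → (marked L).Term α}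
    (h : ∀ x ∈ t.varFinset, maxMark (σ x) ≤ k) : maxMark ((unmarked t).subst σ) ≤ k := by
  induction t with
  | var y => exact h y (by simp [Term.varFinset])
  | func f ts ih =>
    exact maxMark_le_func.2 ⟨Nat.zero_le _, fun i => ih i fun x hx =>
      h x (mem_varFinset_func.2 ⟨i, hx⟩)⟩

theorem maxMark_le_of_fill {k : ℕ} {C : Ctx (marked L)} {t : (marked L).Term Empty}
    (h : maxMark (C.fill t) ≤ k) : maxMark t ≤ k := by
  induction C with
  | hole => exact h
  | func f i ts C ih =>
    have := (maxMark_le_func.1 h).2 i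
    rw [Function.update_self] at this
    exact ih this

theorem le_varMarkAbove_func {n : ℕ} {f : (marked L).Functions n} {ts : Fin n → (marked L).Term ℕ}
    {x : ℕ} {i : Fin n} (hx : x ∈ (ts i).varFinset) :
    max (symMark f) (varMarkAbove x (ts i)) ≤ varMarkAbove x (.func f ts) := by
  have hex : ∃ j, x ∈ (ts j).varFinset := ⟨i, hx⟩
  rw [varMarkAbove, if_pos hex]
  exact max_le_max le_rfl (Finset.le_sup (f := fun j => varMarkAbove x (ts j)) (Finset.mem_univ i))

/-! ### Rewriting below null marks and recognizability -/

/-- The closure of a relation under contexts whose nodes above the hole all have mark `0`. -/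
inductive NullCongr (S : (marked L).Term α → (marked L).Term α → Prop) :
    (marked L).Term α → (marked L).Term α → Prop
  | root {v w} (h : S v w) : NullCongr S v w
  | arg {n : ℕ} (f : (marked L).Functions n) (hf : symMark f = 0) (i : Fin n)
      (vs : Fin n → (marked L).Term α) {w} (h : NullCongr S (vs i) w) :
      NullCongr S (.func f vs) (.func f (Function.update vs i w))

theorem NullCongr.arg_star {S : (marked L).Term α → (marked L).Term α → Prop} {n : ℕ}
    {f : (marked L).Functions n} (hf : symMark f = 0) (i : Fin n)
    (vs : Fin n → (marked L).Term α) {v w} (h : ReflTransGen (NullCongr S) v w) :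
    ReflTransGen (NullCongr S) (.func f (Function.update vs i v))
      (.func f (Function.update vs i w)) := by
  induction h with
  | refl => exact .refl
  | @tail b c _ hbc ih =>
    refine ih.tail ?_
    have := NullCongr.arg (S := S) f hf i (Function.update vs i b) (w := c)
      (by rwa [Function.update_self])
    rwa [Function.update_idem] at this

theorem NullCongr.func_star {S : (marked L).Term α → (marked L).Term α → Prop} {n : ℕ}
    {f : (marked L).Functions n} (hf : symMark f = 0)
    {vs ws : Fin n → (marked L).Term α} (h : ∀ i, ReflTransGen (NullCongr S) (vs i) (ws i)) :
    ReflTransGen (NullCongr S) (.func f vs) (.func f ws) := by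
  classical
  have key : ∀ s : Finset (Fin n), ReflTransGen (NullCongr S) (.func f vs)
      (.func f (s.piecewise ws vs)) := by
    intro s
    induction s using Finset.induction_on with
    | empty => rw [Finset.piecewise_empty]
    | @insert i s hi ih =>
      refine ih.trans ?_
      have hvs : Function.update (s.piecewise ws vs) i (vs i) = s.piecewise ws vs := by
        rw [← Finset.piecewise_eq_of_notMem s ws vs hi, Function.update_eq_self]
      have h1 := NullCongr.arg_star hf i (s.piecewise ws vs) (h i)
      rwa [hvs, ← Finset.piecewise_insert] at h1
  have := key Finset.univ
  rwa [Finset.piecewise_univ] at this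

/-- A derivation from a term whose root has mark `0` either takes place in the arguments only, or
rewrites the arguments up to a first rewriting at the root. -/
theorem NullCongr.star_func_cases {S : (marked L).Term α → (marked L).Term α → Prop} {n : ℕ}
    {f : (marked L).Functions n} {vs : Fin n → (marked L).Term α} {w}
    (h : ReflTransGen (NullCongr S) (.func f vs) w) :
    (∃ ws, w = .func f ws ∧ ∀ i, ReflTransGen (NullCongr S) (vs i) (ws i)) ∨
      ∃ us w', (∀ i, ReflTransGen (NullCongr S) (vs i) (us i)) ∧ S (.func f us) w' ∧
        ReflTransGen (NullCongr S) w' w := by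
  generalize hv : Term.func f vs = v at h
  induction h using ReflTransGen.head_induction_on generalizing vs with
  | refl => exact .inl ⟨vs, hv.symm, fun _ => .refl⟩
  | @head a c hac hcw ih =>
    subst hv
    cases hac with
    | root h => exact .inr ⟨vs, c, fun _ => .refl, h, hcw⟩
    | @arg _ _ hf i _ w' h =>
      have key : ∀ {us : Fin n → (marked L).Term α},
          (∀ j, ReflTransGen (NullCongr S) (Function.update vs i w' j) (us j)) →
          ∀ j, ReflTransGen (NullCongr S) (vs j) (us j) := by
        intro us hus j
        have := hus j
        rcases eq_or_ne j i with rfl | hj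
        · rw [Function.update_self] at this
          exact this.head h
        · rwa [Function.update_of_ne hj] at this
      rcases ih rfl with ⟨ws, hw, hws⟩ | ⟨us, x, hus, hx, hxw⟩
      · exact .inl ⟨ws, hw, key hws⟩
      · exact .inr ⟨us, x, key hus, hx, hxw⟩

/-- A ground term as a marked term with null marks and leaves in an arbitrary type. -/
def embed (α : Type) : L.Term Empty → (marked L).Term α
  | .var x => x.elim
  | .func f ts => .func (nullMark f) fun i => embed α (ts i)

/-- If all the redexes of a relation lie in a finite set `W` closed under arguments, then the
ground terms from which a given finite set of elements of `W` can be reached are recognized by an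
automaton with set of states `W`: its transitions are read off the reachability relation itself, so
no saturation is needed. -/
theorem recognizable_of_finite_redexes {S : (marked L).Term α → (marked L).Term α → Prop}
    {W : Set ((marked L).Term α)} (hW : W.Finite) (hS : ∀ v w, S v w → v ∈ W)
    (hsub : ∀ {n : ℕ} (f : (marked L).Functions n) (ts : Fin n → (marked L).Term α),
      .func f ts ∈ W → ∀ i, ts i ∈ W)
    {F : Set ((marked L).Term α)} (hF : F ⊆ W) :
    Recognizable {s : L.Term Empty | ∃ w ∈ F, ReflTransGen (NullCongr S) (embed α s) w} := by
  have := hW.to_subtype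
  obtain ⟨n, ⟨e⟩⟩ := Finite.exists_equiv_fin W
  let A : TreeAutomaton L (Fin n) :=
    { trans := fun f p => {q | ReflTransGen (NullCongr S)
        (.func (nullMark f) fun i => (e.symm (p i)).1) (e.symm q).1}
      final := {q | (e.symm q).1 ∈ F} }
  have key : ∀ (s : L.Term Empty) (q : Fin n),
      q ∈ A.states s ↔ ReflTransGen (NullCongr S) (embed α s) (e.symm q).1 := by
    intro s
    induction s with
    | var x => exact x.elim
    | func f ts ih =>
      intro q
      constructor
      · rintro ⟨p, hp, hq⟩
        exact (NullCongr.func_star rfl fun i => (ih i _).1 (hp i)).trans hq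
      · intro h
        rcases NullCongr.star_func_cases h with ⟨ws, hw, hws⟩ | ⟨us, w', hus, hS', hw'⟩
        · have hmem : ∀ i, ws i ∈ W := hsub _ ws (hw ▸ (e.symm q).2)
          refine ⟨fun i => e ⟨ws i, hmem i⟩, fun i => (ih i _).2 (by simpa using hws i), ?_⟩
          change ReflTransGen _ _ _
          simp only [Equiv.symm_apply_apply]
          rw [hw]
        · have hmem : ∀ i, us i ∈ W := hsub _ us (hS _ _ hS')
          refine ⟨fun i => e ⟨us i, hmem i⟩, fun i => (ih i _).2 (by simpa using hus i), ?_⟩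
          change ReflTransGen _ _ _
          simp only [Equiv.symm_apply_apply]
          exact hw'.head (.root hS')
  refine ⟨Fin n, inferInstance, A, ?_⟩
  ext s
  constructor
  · rintro ⟨q, hq, hs⟩
    exact ⟨_, hq, (key s q).1 hs⟩
  · rintro ⟨w, hw, hs⟩
    refine ⟨e ⟨w, hF hw⟩, ?_, (key s _).2 (by simpa using hs)⟩
    change (e.symm _).1 ∈ F
    simpa using hw

/-- The marked terms of bounded height and bounded marks. -/
def boundedTerms (L : FirstOrder.Language.{u, v}) (α : Type) (H k : ℕ) : Set ((marked L).Term α) :=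
  {w | height w ≤ H ∧ maxMark w ≤ k}

theorem height_le_func {M : FirstOrder.Language.{u, v}} {H n : ℕ} {f : M.Functions n}
    {ts : Fin n → M.Term α} : height (.func f ts) ≤ H + 1 ↔ ∀ i, height (ts i) ≤ H := by
  simp [height]

theorem arg_mem_boundedTerms {H k n : ℕ} {f : (marked L).Functions n}
    {ts : Fin n → (marked L).Term α} (h : .func f ts ∈ boundedTerms L α H k) (i : Fin n) :
    ts i ∈ boundedTerms L α H k := by
  refine ⟨?_, (maxMark_le_func.1 h.2).2 i⟩
  have h1 := h.1
  cases H with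
  | zero => simp [height] at h1
  | succ H => exact (height_le_func.1 h1 i).trans (Nat.le_succ H)

theorem finite_boundedTerms [Finite (Σ n, L.Functions n)] [Finite α] (H k : ℕ) :
    (boundedTerms L α H k).Finite := by
  induction H with
  | zero =>
    refine (Set.finite_range (Term.var : α → (marked L).Term α)).subset ?_
    rintro (x | ⟨f, ts⟩) ⟨h, _⟩
    · exact ⟨x, rfl⟩
    · simp [height] at h
  | succ H ih =>
    have hfin : (⋃ (p : (Σ n, L.Functions n) × Fin (k + 1)),
        (fun ts => Term.func (L := marked L) (l := p.1.1) (p.1.2, (p.2 : ℕ)) ts) ''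
          Set.univ.pi fun _ => boundedTerms L α H k).Finite :=
      Set.finite_iUnion fun p => (Set.Finite.pi fun _ => ih).image _
    refine ((Set.finite_range (Term.var : α → (marked L).Term α)).union hfin).subset ?_
    rintro (x | @⟨n, f, ts⟩) ⟨h, hk⟩
    · exact .inl ⟨x, rfl⟩
    · rw [maxMark_le_func] at hk
      rw [height_le_func] at h
      refine .inr (Set.mem_iUnion.2
        ⟨⟨⟨n, Prod.fst f⟩, ⟨symMark f, Nat.lt_succ_of_le hk.1⟩⟩, ts, ?_, rfl⟩)
      exact fun i _ => ⟨h i, hk.2 i⟩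

/-- Adding a sink state makes every ground term reducible to some state. -/
theorem Recognizable.exists_complete {T : Set (L.Term Empty)} (hT : Recognizable T) :
    ∃ (Q : Type) (_ : Finite Q) (A : TreeAutomaton L Q),
      A.language = T ∧ ∀ t, (A.states t).Nonempty := by
  obtain ⟨Q, hQ, A, rfl⟩ := hT
  let B : TreeAutomaton L (Option Q) :=
    { trans := fun f p => {q | q = none ∨ ∃ (p' : _ → Q) (q' : Q),
        p = (fun i => some (p' i)) ∧ q = some q' ∧ q' ∈ A.trans f p'}
      final := some '' A.final }
  have hnone : ∀ t : L.Term Empty, none ∈ B.states t := by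
    intro t
    induction t with
    | var x => exact x.elim
    | func f ts ih => exact ⟨fun _ => none, ih, .inl rfl⟩
  have hsome : ∀ (t : L.Term Empty) (q : Q), some q ∈ B.states t ↔ q ∈ A.states t := by
    intro t
    induction t with
    | var x => exact x.elim
    | func f ts ih =>
      intro q
      constructor
      · rintro ⟨p, hp, h | ⟨p', q', rfl, hq, hq'⟩⟩
        · cases h
        · cases hq
          exact ⟨p', fun i => (ih i _).1 (hp i), hq'⟩
      · rintro ⟨p, hp, hq⟩
        exact ⟨fun i => some (p i), fun i => (ih i _).2 (hp i), .inr ⟨p, q, rfl, rfl, hq⟩⟩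
  refine ⟨Option Q, inferInstance, B, ?_, fun t => ⟨none, hnone t⟩⟩
  ext t
  constructor
  · rintro ⟨_, ⟨q, hq, rfl⟩, h⟩
    exact ⟨q, hq, (hsome t q).1 h⟩
  · rintro ⟨q, hq, h⟩
    exact ⟨some q, ⟨q, hq, rfl⟩, (hsome t q).2 h⟩

/-! ### Truncated terms -/

/-- `Trunc A t v`: the term `v` is obtained from the ground marked term `t` by replacing some
subterms by states of `A` to which they can be reduced; the remaining marks are unchanged. -/
inductive Trunc (A : TreeAutomaton L Q) : (marked L).Term Empty → (marked L).Term Q → Prop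
  | leaf (t q) (h : q ∈ A.states (erase t)) : Trunc A t (.var q)
  | node {n : ℕ} (f : (marked L).Functions n) (ts vs) (h : ∀ i, Trunc A (ts i) (vs i)) :
      Trunc A (.func f ts) (.func f vs)

variable {A : TreeAutomaton L Q}

theorem Trunc.maxMark_le {t v} (h : Trunc A t v) {k : ℕ} (ht : maxMark t ≤ k) :
    maxMark v ≤ k := by
  induction h with
  | leaf t q h => exact Nat.zero_le _
  | node f ts vs h ih =>
    rw [maxMark_le_func] at ht ⊢
    exact ⟨ht.1, fun i => ih i (ht.2 i)⟩

theorem Trunc.states_of_var {t q} (h : Trunc A t (.var q)) : q ∈ A.states (erase t) := by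
  cases h
  assumption

theorem Trunc.raise {t v} (h : Trunc A t v) (n : ℕ) : Trunc A (raise n t) (raise n v) := by
  induction h with
  | leaf t q h => exact .leaf _ _ (by rwa [erase_raise])
  | node f ts vs h ih => exact .node _ _ _ ih

theorem Trunc.of_raise {n : ℕ} {t w} (h : Trunc A (BottomUp.raise n t) w) :
    ∃ v, w = BottomUp.raise n v ∧ Trunc A t v := by
  induction t generalizing w with
  | var x => exact x.elim
  | func f ts ih =>
    rw [raise_func] at h
    cases h with
    | leaf _ q h => exact ⟨.var q, rfl, .leaf _ _ (by rwa [← raise_func, erase_raise] at h)⟩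
    | node _ _ ws h =>
      choose vs hws hvs using fun i => ih i (h i)
      obtain rfl : ws = fun i => BottomUp.raise n (vs i) := funext hws
      exact ⟨.func f vs, rfl, .node _ _ _ hvs⟩

theorem Trunc.subst {l : (marked L).Term ℕ} {σ : ℕ → (marked L).Term Empty}
    {τ : ℕ → (marked L).Term Q} (h : ∀ x ∈ l.varFinset, Trunc A (σ x) (τ x)) :
    Trunc A (l.subst σ) (l.subst τ) := by
  induction l with
  | var x => exact h x (by simp [Term.varFinset])
  | func f ts ih =>
    exact .node _ _ _ fun i => ih i fun x hx => h x (mem_varFinset_func.2 ⟨i, hx⟩)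

/-- A redex of a truncation comes from a redex of the term itself: this uses the linearity of the
left-hand side. -/
theorem Trunc.of_subst {l : (marked L).Term ℕ} (hl : LinearTerm l)
    {t : (marked L).Term Empty} {τ : ℕ → (marked L).Term Q} (h : Trunc A t (l.subst τ)) :
    ∃ σ : ℕ → (marked L).Term Empty,
      t = l.subst σ ∧ ∀ x ∈ l.varFinset, Trunc A (σ x) (τ x) := by
  induction l generalizing t with
  | var x =>
    refine ⟨fun _ => t, rfl, fun y hy => ?_⟩
    simp only [Term.varFinset, Finset.mem_singleton] at hy
    exact hy ▸ h
  | func f ls ih =>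
    cases h with
    | node _ ts _ h =>
      exact hl.glue (P := fun x u => Trunc A u (τ x)) (fun i => ih i (hl.arg i) (h i))
        fun _ => .func f ts

theorem Trunc.embed (t : L.Term Empty) : Trunc A (unmarked t) (embed Q t) := by
  induction t with
  | var x => exact x.elim
  | func f ts ih => exact .node _ _ _ ih

/-! ### The truncated rewriting system -/

/-- The root steps of the truncated system: on terms of bounded size, reducing a symbol with mark
`0` by a transition of `A`, and the marked rewriting steps of `R` at a root with mark `0`. -/
inductive TruncStep (R : Set (Rule L)) (A : TreeAutomaton L Q) (k H : ℕ) :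
    (marked L).Term Q → (marked L).Term Q → Prop
  | eval {n : ℕ} (f : (marked L).Functions n) (hf : symMark f = 0) (p : Fin n → Q) (q : Q)
      (hq : q ∈ A.trans (Prod.fst f) p) (v) (hv : v = .func f fun i => .var (p i))
      (hb : v ∈ boundedTerms L Q H k) : TruncStep R A k H v (.var q)
  | rewrite (ρ : Rule L) (hρ : ρ ∈ R) (l : (marked L).Term ℕ) (τ : ℕ → (marked L).Term Q)
      (hl : erase l = ρ.lhs) (h0 : rootMark l = 0)
      (hk : ∀ x ∈ ρ.rhs.varFinset, varMarkAbove x l < k) (v) (hv : v = l.subst τ)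
      (hb : v ∈ boundedTerms L Q H k) :
      TruncStep R A k H v
        ((unmarked ρ.rhs).subst fun x => raise (nextMark .hole l x) (τ x))

theorem nextMark_hole (l : (marked L).Term ℕ) (x : ℕ) :
    nextMark .hole l x = varMarkAbove x l + 1 := by
  simp [nextMark, Ctx.markAbove]

theorem TruncStep.mem {R : Set (Rule L)} {k H : ℕ} {v w} (h : TruncStep R A k H v w) :
    v ∈ boundedTerms L Q H k := by
  cases h <;> assumption

variable {R : Set (Rule L)} {k H : ℕ}

/-! ### Steps of the truncated system lift to derivations -/

theorem BUStep.arg {n : ℕ} {f : (marked L).Functions n} (hf : symMark f = 0)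
    {ts : Fin n → (marked L).Term Empty} (hts : ∀ i, maxMark (ts i) ≤ k) (i : Fin n) {s t}
    (h : BUStep R k s t) :
    BUStep R k (.func f (Function.update ts i s)) (.func f (Function.update ts i t)) := by
  obtain ⟨hs, ht, ρ, hρ, C, l, ⟨hl, σ, rfl, rfl⟩, hw⟩ := h
  have hmark : ∀ {u}, maxMark u ≤ k →
      maxMark (Term.func f (Function.update ts i u)) ≤ k := by
    intro u hu
    refine maxMark_le_func.2 ⟨hf ▸ Nat.zero_le _, fun j => ?_⟩
    rcases eq_or_ne j i with rfl | hj
    · rwa [Function.update_self]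
    · rw [Function.update_of_ne hj]
      exact hts j
  have hC : (Ctx.func f i ts C).markAbove = C.markAbove := by simp [Ctx.markAbove, hf]
  refine ⟨hmark hs, hmark ht, ρ, hρ, .func f i ts C, l, ⟨hl, σ, rfl, ?_⟩, hw.1, fun hv => ?_⟩
  · simp only [nextMark, hC]
    rfl
  · rw [hC]
    exact hw.2 hv

theorem BUStep.arg_star {n : ℕ} {f : (marked L).Functions n} (hf : symMark f = 0)
    {ts : Fin n → (marked L).Term Empty} (hts : ∀ i, maxMark (ts i) ≤ k) (i : Fin n) {s t}
    (h : ReflTransGen (BUStep R k) s t) :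
    ReflTransGen (BUStep R k) (.func f (Function.update ts i s))
      (.func f (Function.update ts i t)) := by
  induction h with
  | refl => exact .refl
  | tail _ hbc ih => exact ih.tail (hbc.arg hf hts i)

theorem Trunc.lift_step (hR : LinearSystem R) {t v w} (h : Trunc A t v) (ht : maxMark t ≤ k)
    (hvw : NullCongr (TruncStep R A k H) v w) :
    ∃ t', ReflTransGen (BUStep R k) t t' ∧ Trunc A t' w ∧ maxMark t' ≤ k := by
  induction hvw generalizing t with
  | root hvw =>
    cases hvw with
    | eval f hf p q hq _ hv _ =>
      subst hv
      cases h with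
      | node _ ts _ h =>
        exact ⟨_, .refl, .leaf _ _ ⟨p, fun i => (h i).states_of_var, hq⟩, ht⟩
    | rewrite ρ hρ l τ hl h0 hk _ hv _ =>
      subst hv
      obtain ⟨σ, rfl, hσ⟩ := h.of_subst (linearTerm_of_erase (hl ▸ (hR ρ hρ).1))
      have hlr : ∀ x ∈ ρ.rhs.varFinset, x ∈ l.varFinset := fun x hx => by
        rw [← varFinset_erase, hl]
        exact ρ.vars_subset hx
      have hmark : maxMark ((unmarked ρ.rhs).subst fun x =>
          BottomUp.raise (nextMark .hole l x) (σ x)) ≤ k :=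
        maxMark_unmarked_subst_le fun x hx => maxMark_raise_le
          (by rw [nextMark_hole]; exact hk x hx) (maxMark_le_of_subst ht (hlr x hx))
      refine ⟨_, .single ⟨ht, hmark, ρ, hρ, .hole, l, ⟨hl, σ, rfl, rfl⟩, fun _ => h0,
        fun _ => rfl⟩, .subst fun x hx => ?_, hmark⟩
      rw [varFinset_unmarked] at hx
      exact (hσ x (hlr x hx)).raise _
  | arg f hf i vs hvw ih =>
    cases h with
    | node _ ts _ h =>
      rw [maxMark_le_func] at ht
      obtain ⟨t', hstep, htr, ht'⟩ := ih (h i) (ht.2 i)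
      refine ⟨.func f (Function.update ts i t'), ?_, .node _ _ _ fun j => ?_,
        maxMark_le_func.2 ⟨ht.1, fun j => ?_⟩⟩
      · simpa using BUStep.arg_star hf ht.2 i hstep
      · rcases eq_or_ne j i with rfl | hj
        · simpa using htr
        · simpa [hj] using h j
      · rcases eq_or_ne j i with rfl | hj
        · simpa using ht'
        · simpa [hj] using ht.2 j

theorem Trunc.lift_star (hR : LinearSystem R) {t v w} (h : Trunc A t v) (ht : maxMark t ≤ k)
    (hvw : ReflTransGen (NullCongr (TruncStep R A k H)) v w) :
    ∃ t', ReflTransGen (BUStep R k) t t' ∧ Trunc A t' w := by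
  induction hvw using ReflTransGen.head_induction_on generalizing t with
  | refl => exact ⟨t, .refl, h⟩
  | head hac _ ih =>
    obtain ⟨t', h1, h2, h3⟩ := h.lift_step hR ht hac
    obtain ⟨t'', h4, h5⟩ := ih h2 h3
    exact ⟨t'', h1.trans h4, h5⟩

/-! ### Truncations of bounded height -/

/-- `Fit k d a b w` bounds the height of a truncated term along each of its branches, read from the
root. The branch is cut into blocks of at most `d` symbols, `b` of which are still available in the
current block, and `a` is the greatest mark met so far, where each new block counts as increasing
`a` by one. Each block stands for the part of the branch that is consumed by one future left-hand
side: the symbols below it then get a greater mark. Hence `a ≤ k` bounds the number of blocks. -/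
inductive Fit (k d : ℕ) : ℕ → ℕ → (marked L).Term Q → Prop
  | leaf (a b q) : Fit k d a b (.var q)
  | node {n : ℕ} (a b : ℕ) (f : (marked L).Functions n) (ws)
      (h : ∀ i, Fit k d (max a (symMark f)) b (ws i)) : Fit k d a (b + 1) (.func f ws)
  | next (a b w) (ha : a < k) (h : Fit k d (a + 1) d w) : Fit k d a b w

variable {d : ℕ}

theorem Fit.height_le {a b : ℕ} {w : (marked L).Term Q} (h : Fit k d a b w) (ha : a ≤ k)
    (hw : maxMark w ≤ k) : height w ≤ b + (k - a) * d := by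
  induction h with
  | leaf a b q => exact Nat.zero_le _
  | node a b f ws h ih =>
    rw [maxMark_le_func] at hw
    rw [show b + 1 + (k - a) * d = b + (k - a) * d + 1 by omega, height_le_func]
    intro i
    refine (ih i (max_le ha hw.1) (hw.2 i)).trans ?_
    gcongr
    exact le_max_left _ _
  | next a b w ha' h ih =>
    refine (ih ha' hw).trans ?_
    rw [show k - a = (k - (a + 1)) + 1 by omega, Nat.succ_mul]
    omega

theorem Fit.mono {a a' b b' : ℕ} {w : (marked L).Term Q} (h : Fit k d a b w) (ha : a' ≤ a)
    (hb : b ≤ b') : Fit k d a' b' w := by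
  induction h generalizing a' b' with
  | leaf a b q => exact .leaf _ _ _
  | node a b f ws h ih =>
    obtain ⟨c, rfl⟩ : ∃ c, b' = c + 1 := ⟨b' - 1, by omega⟩
    exact .node _ _ _ _ fun i => ih i (max_le_max ha le_rfl) (by omega)
  | next a b w ha' h ih => exact .next _ _ _ (by omega) (ih (by omega) le_rfl)

theorem Fit.arg {a b n : ℕ} {f : (marked L).Functions n} {ws : Fin n → (marked L).Term Q}
    (h : Fit k d a b (.func f ws)) (hb : b ≤ d) (i : Fin n) : Fit k d a d (ws i) := by
  generalize hw : Term.func f ws = w at h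
  induction h with
  | leaf a b q => cases hw
  | node a b f ws h ih =>
    cases hw
    exact (h i).mono (le_max_left _ _) (by omega)
  | next a b w ha h ih => exact (ih le_rfl hw).mono (by omega) le_rfl

/-- Starting with a greatest mark `1` costs nothing when the root has a positive mark. -/
theorem Fit.promote {a b n : ℕ} {f : (marked L).Functions n} {ws : Fin n → (marked L).Term Q}
    (h : Fit k d a b (.func f ws)) (hb : b ≤ d) (hf : 1 ≤ symMark f) :
    Fit k d 1 d (.func f ws) := by
  cases h with
  | node _ b _ _ h =>
    refine Fit.mono (.node 1 b f ws fun i => (h i).mono ?_ le_rfl) le_rfl hb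
    exact max_le (hf.trans (le_max_right _ _)) (le_max_right _ _)
  | next _ _ _ _ h => exact h.mono (by omega) le_rfl

theorem Fit.of_raise_of_le {m a b : ℕ} {w : (marked L).Term Q} (h : Fit k d a b (raise m w))
    (hm : m ≤ a) : Fit k d a b w := by
  generalize hv : raise m w = v at h
  induction h generalizing w with
  | leaf a b q =>
    cases w with
    | var x => exact .leaf _ _ _
    | func f ws => cases hv
  | node a b f vs h ih =>
    cases w with
    | var x => cases hv
    | func g ws =>
      rw [raise_func] at hv
      cases hv
      refine .node _ _ _ _ fun i => (ih i (hm.trans (le_max_left _ _)) rfl).mono ?_ le_rfl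
      exact max_le_max le_rfl (le_max_left _ _)
  | next a b v ha h ih => exact .next _ _ _ ha (ih (by omega) hv)

/-- Once the marks are raised to `m`, entering the term uses up all the blocks of level below `m`,
so that the bound already holds at level `m` with the former marks. -/
theorem Fit.of_raise {m a b : ℕ} {w : (marked L).Term Q} (h : Fit k d a b (raise m w))
    (hb : b ≤ d) (ham : a ≤ m) : Fit k d m d w := by
  generalize hv : raise m w = v at h
  induction h with
  | leaf a b q =>
    cases w with
    | var x => exact .leaf _ _ _
    | func f ws => cases hv
  | node a b f vs h ih =>
    cases w with
    | var x => cases hv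
    | func g ws =>
      rw [raise_func] at hv
      cases hv
      refine Fit.mono (.node m b g ws fun i => Fit.of_raise_of_le (m := m) ((h i).mono ?_ le_rfl)
        (le_max_left _ _)) le_rfl hb
      rw [symMark_raiseSym]
      exact max_le (le_max_of_le_right (le_max_right _ _)) (le_max_of_le_right (le_max_left _ _))
  | next a b v ha h ih =>
    rcases Nat.lt_or_ge a m with hlt | hge
    · exact ih le_rfl hlt hv
    · subst hv
      exact (Fit.of_raise_of_le h (by omega)).mono (by omega) le_rfl

/-- A left-hand side of height at most `b` fits into the current block. Bound `0` at a variable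
means that its image is a leaf or starts a new block, which requires the mark above to be `< k`. -/
theorem Fit.subst {a b : ℕ} {l : (marked L).Term ℕ} {τ : ℕ → (marked L).Term Q}
    (hl : height l ≤ b) (h : ∀ x ∈ l.varFinset, Fit k d (max a (varMarkAbove x l)) 0 (τ x)) :
    Fit k d a b (l.subst τ) := by
  induction l generalizing a b with
  | var x => exact (h x (by simp [Term.varFinset])).mono (le_max_left _ _) (Nat.zero_le _)
  | func f ls ih =>
    obtain ⟨c, rfl⟩ : ∃ c, b = c + 1 := ⟨b - 1, by simp only [height] at hl; omega⟩
    rw [height_le_func] at hl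
    refine .node _ _ _ _ fun i => ih i (hl i) fun x hx =>
      (h x (mem_varFinset_func.2 ⟨i, hx⟩)).mono ?_ le_rfl
    rw [max_assoc]
    exact max_le_max le_rfl (le_varMarkAbove_func hx)

/-! ### Derivations project to the truncated system -/

/-- `Adm A k d t v`: the truncation `v` of `t` keeps all the nodes that can be reached from the root
through marks `0`, and its parts below satisfy the bound `Fit`. -/
inductive Adm (A : TreeAutomaton L Q) (k d : ℕ) :
    (marked L).Term Empty → (marked L).Term Q → Prop
  | null {n : ℕ} (f : (marked L).Functions n) (hf : symMark f = 0) (ts vs)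
      (h : ∀ i, Adm A k d (ts i) (vs i)) : Adm A k d (.func f ts) (.func f vs)
  | frozen (t v) (ht : 1 ≤ rootMark t) (h : Trunc A t v) (hv : Fit k d 1 d v) : Adm A k d t v

theorem Adm.func_inv {n : ℕ} {f : (marked L).Functions n} (hf : symMark f = 0)
    {ts : Fin n → (marked L).Term Empty} {v : (marked L).Term Q} (h : Adm A k d (.func f ts) v) :
    ∃ vs, v = .func f vs ∧ ∀ i, Adm A k d (ts i) (vs i) := by
  cases h with
  | null _ _ _ vs h => exact ⟨vs, rfl, h⟩
  | frozen _ _ ht =>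
    change 1 ≤ symMark f at ht
    omega

theorem Adm.frozen_inv {t : (marked L).Term Empty} {v : (marked L).Term Q}
    (h : Adm A k d t v) (ht : 1 ≤ rootMark t) : Trunc A t v ∧ Fit k d 1 d v := by
  cases h with
  | null f hf =>
    change 1 ≤ symMark f at ht
    omega
  | frozen _ _ _ h hv => exact ⟨h, hv⟩

/-- Below a term with null marks, the truncation is also an instance of that term: this uses the
linearity of the right-hand side. -/
theorem Adm.of_unmarked_subst {r : L.Term ℕ} (hr : LinearTerm r)
    {σ : ℕ → (marked L).Term Empty} {v : (marked L).Term Q}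
    (h : Adm A k d ((unmarked r).subst σ) v) :
    ∃ τ : ℕ → (marked L).Term Q,
      v = (unmarked r).subst τ ∧ ∀ x ∈ (unmarked r).varFinset, Adm A k d (σ x) (τ x) := by
  induction r generalizing v with
  | var x =>
    refine ⟨fun _ => v, rfl, fun y hy => ?_⟩
    simp only [unmarked_var, Term.varFinset, Finset.mem_singleton] at hy
    exact hy ▸ h
  | func f rs ih =>
    obtain ⟨vs, rfl, hvs⟩ := h.func_inv rfl
    exact (linearTerm_unmarked hr).glue (fun i => ih i (hr.arg i) (hvs i))
      fun _ => .func (nullMark f) vs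

theorem Adm.eq_embed {t : L.Term Empty} {v : (marked L).Term Q}
    (h : Adm A k d (unmarked t) v) : v = embed Q t := by
  induction t generalizing v with
  | var x => exact x.elim
  | func f ts ih =>
    obtain ⟨vs, rfl, hvs⟩ := h.func_inv rfl
    exact congrArg (Term.func _) (funext fun i => ih i (hvs i))

/-- A term that reduces to `q` can be cut at its maximal subterms with a positive root mark, after
which the transitions of `A` evaluate the nodes above these subterms. -/
theorem Adm.exists_star_var (hH : 1 ≤ H) {t : (marked L).Term Empty} {q : Q}
    (hq : q ∈ A.states (erase t)) :
    ∃ v, Adm A k d t v ∧ ReflTransGen (NullCongr (TruncStep R A k H)) v (.var q) := by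
  induction t generalizing q with
  | var x => exact x.elim
  | func f ts ih =>
    rcases Nat.eq_zero_or_pos (symMark f) with hf | hf
    · obtain ⟨p, hp, hq⟩ := hq
      choose vs hvs hstar using fun i => ih i (hp i)
      refine ⟨.func f vs, .null f hf _ _ hvs, (NullCongr.func_star hf hstar).tail
        (.root (.eval f hf p q hq _ rfl ⟨?_, ?_⟩))⟩
      · obtain ⟨c, rfl⟩ : ∃ c, H = c + 1 := ⟨H - 1, by omega⟩
        exact height_le_func.2 fun i => Nat.zero_le _
      · exact maxMark_le_func.2 ⟨hf ▸ Nat.zero_le _, fun i => Nat.zero_le _⟩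
    · exact ⟨.var q, .frozen _ _ hf (.leaf _ _ hq) (.leaf _ _ _), .refl⟩

/-- Every truncation satisfying the height bound is reached from one that keeps the nodes with mark
`0`, by evaluating these nodes. -/
theorem Adm.exists_star_of_fit (hH : 1 ≤ H) {t w} (h : Trunc A t w) {a : ℕ}
    (hw : Fit k d a d w) :
    ∃ v, Adm A k d t v ∧ ReflTransGen (NullCongr (TruncStep R A k H)) v w := by
  induction h with
  | leaf t q h => exact Adm.exists_star_var hH h
  | node f ts ws h ih =>
    rcases Nat.eq_zero_or_pos (symMark f) with hf | hf
    · choose vs hvs hstar using fun i => ih i (hw.arg le_rfl i)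
      exact ⟨.func f vs, .null f hf _ _ hvs, NullCongr.func_star hf hstar⟩
    · exact ⟨_, .frozen _ _ hf (.node f ts ws h) (hw.promote le_rfl hf), .refl⟩

/-- The marks of a ground term do not decrease from a node to its arguments. -/
def Increasing : (marked L).Term Empty → Prop
  | .var x => x.elim
  | .func f ts => ∀ i, symMark f ≤ rootMark (ts i) ∧ Increasing (ts i)

theorem increasing_unmarked (t : L.Term Empty) : Increasing (unmarked t) := by
  induction t with
  | var x => exact x.elim
  | func f ts ih => exact fun i => ⟨Nat.zero_le _, ih i⟩

theorem Increasing.raise {t : (marked L).Term Empty} (h : Increasing t) (n : ℕ) :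
    Increasing (raise n t) := by
  induction t with
  | var x => exact x.elim
  | func f ts ih =>
    refine fun i => ⟨?_, ih i (h i).2⟩
    have h1 := (h i).1
    change max (symMark f) n ≤ rootMark (BottomUp.raise n (ts i))
    cases hti : ts i with
    | var x => exact x.elim
    | func g us =>
      rw [hti] at h1
      exact max_le_max h1 le_rfl

theorem Increasing.of_subst {l : (marked L).Term ℕ} {σ : ℕ → (marked L).Term Empty}
    (h : Increasing (l.subst σ)) {x : ℕ} (hx : x ∈ l.varFinset) : Increasing (σ x) := by
  induction l with
  | var y =>
    simp only [Term.varFinset, Finset.mem_singleton] at hx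
    exact hx ▸ h
  | func f ls ih =>
    obtain ⟨i, hi⟩ := mem_varFinset_func.1 hx
    exact ih i (h i).2 hi

theorem Increasing.unmarked_subst {r : L.Term ℕ} {σ : ℕ → (marked L).Term Empty}
    (h : ∀ x ∈ r.varFinset, Increasing (σ x)) : Increasing ((unmarked r).subst σ) := by
  induction r with
  | var y => exact h y (by simp [Term.varFinset])
  | func f rs ih =>
    exact fun i => ⟨Nat.zero_le _, ih i fun x hx => h x (mem_varFinset_func.2 ⟨i, hx⟩)⟩

/-- The last conjunct compares the root of `C[t]` with the nodes above the hole; it carries the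
induction. -/
theorem Increasing.of_fill {C : Ctx (marked L)} {t : (marked L).Term Empty}
    (h : Increasing (C.fill t)) :
    Increasing t ∧ C.markAbove ≤ rootMark t ∧ (C = .hole ∨ rootMark (C.fill t) ≤ C.markAbove) := by
  induction C with
  | hole => exact ⟨h, Nat.zero_le _, .inl rfl⟩
  | func f i ts C ih =>
    have h1 := h i
    rw [Function.update_self] at h1
    obtain ⟨h2, h3, h4⟩ := ih h1.2
    refine ⟨h2, max_le ?_ h3, .inr (le_max_left _ _)⟩
    rcases h4 with rfl | h4
    · exact h1.1
    · exact (h1.1.trans h4).trans h3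

theorem Increasing.fill {C : Ctx (marked L)} {s t : (marked L).Term Empty}
    (h : Increasing (C.fill s)) (hC : C.markAbove = 0) (ht : Increasing t) :
    Increasing (C.fill t) := by
  induction C with
  | hole => exact ht
  | func f i ts C ih =>
    simp only [Ctx.markAbove, Nat.max_eq_zero_iff] at hC
    intro j
    refine ⟨hC.1 ▸ Nat.zero_le _, ?_⟩
    have hj := (h j).2
    rcases eq_or_ne j i with rfl | hj'
    · rw [Function.update_self] at hj ⊢
      exact ih hj hC.2
    · rw [Function.update_of_ne hj'] at hj ⊢
      exact hj

/-- In a term with increasing marks, a weakly bottom-up step takes place below null marks, whether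
its left-hand side is a variable or not. -/
theorem WeaklyBottomUp.markAbove_eq_zero {ρ : Rule L} {C : Ctx (marked L)}
    {l : (marked L).Term ℕ} {σ : ℕ → (marked L).Term Empty} (h : WeaklyBottomUp ρ C l)
    (hl : erase l = ρ.lhs) (hi : Increasing (C.fill (l.subst σ))) :
    C.markAbove = 0 ∧ rootMark l = 0 := by
  cases l with
  | var x => exact ⟨h.2 ⟨x, hl.symm⟩, rfl⟩
  | func f ls =>
    have h0 : symMark f = 0 := h.1 (by rintro ⟨x, hx⟩; rw [hx] at hl; cases hl)
    exact ⟨Nat.le_zero.1 (hi.of_fill.2.1.trans h0.le), h0⟩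

theorem BUStep.increasing {s t : (marked L).Term Empty} (h : BUStep R k s t)
    (hs : Increasing s) : Increasing t := by
  obtain ⟨_, _, ρ, _, C, l, ⟨hl, σ, rfl, rfl⟩, hw⟩ := h
  refine hs.fill (hw.markAbove_eq_zero hl hs).1 (.unmarked_subst fun x hx => ?_)
  refine (hs.of_fill.1.of_subst ?_).raise _
  rw [← varFinset_erase, hl]
  exact ρ.vars_subset hx

theorem Adm.fill {S : (marked L).Term Q → (marked L).Term Q → Prop} {C : Ctx (marked L)}
    (hC : C.markAbove = 0) {s t : (marked L).Term Empty}
    (hst : ∀ w, Adm A k d t w → ∃ v, Adm A k d s v ∧ ReflTransGen (NullCongr S) v w) {w}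
    (h : Adm A k d (C.fill t) w) :
    ∃ v, Adm A k d (C.fill s) v ∧ ReflTransGen (NullCongr S) v w := by
  induction C generalizing w with
  | hole => exact hst w h
  | func f i ts C ih =>
    simp only [Ctx.markAbove, Nat.max_eq_zero_iff] at hC
    obtain ⟨ws, rfl, hws⟩ := h.func_inv hC.1
    have hi := hws i
    rw [Function.update_self] at hi
    obtain ⟨v, hv, hvw⟩ := ih hC.2 hi
    refine ⟨.func f (Function.update ws i v), .null f hC.1 _ _ fun j => ?_, ?_⟩
    · rcases eq_or_ne j i with rfl | hj
      · simpa using hv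
      · have := hws j
        rw [Function.update_of_ne hj] at this
        simpa [hj] using this
    · simpa using NullCongr.arg_star hC.1 i ws hvw

/-- A step at the root is simulated by a root step of the truncated system, preceded by the
evaluation of the nodes with mark `0` that get a greater mark and are never used afterwards. -/
theorem Adm.exists_star_of_root_step (hA : ∀ t, (A.states t).Nonempty) (hR : LinearSystem R)
    (hd : ∀ ρ ∈ R, height ρ.lhs ≤ d) {ρ : Rule L} (hρ : ρ ∈ R) {l : (marked L).Term ℕ}
    (hl : erase l = ρ.lhs) (h0 : rootMark l = 0) {σ : ℕ → (marked L).Term Empty}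
    (hs : maxMark (l.subst σ) ≤ k)
    (ht : maxMark ((unmarked ρ.rhs).subst fun x => BottomUp.raise (nextMark .hole l x) (σ x)) ≤ k)
    {w : (marked L).Term Q}
    (h : Adm A k d ((unmarked ρ.rhs).subst fun x => BottomUp.raise (nextMark .hole l x) (σ x)) w) :
    ∃ v, Adm A k d (l.subst σ) v ∧
      ReflTransGen (NullCongr (TruncStep R A k (d + k * d + 1))) v w := by
  classical
  obtain ⟨τ', rfl, hτ'⟩ := h.of_unmarked_subst (hR ρ hρ).2
  have hmark : ∀ x ∈ (unmarked ρ.rhs).varFinset, varMarkAbove x l < k := fun x hx => by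
    have := (le_rootMark_raise (nextMark .hole l x) (σ x)).trans
      ((rootMark_le_maxMark _).trans (maxMark_le_of_subst ht hx))
    rwa [nextMark_hole] at this
  -- The variables of the right-hand side keep the truncation chosen after the step, with the marks
  -- it had before; those that are erased are reduced to an arbitrary state.
  have hex : ∀ x, ∃ u : (marked L).Term Q, Trunc A (σ x) u ∧ Fit k d (varMarkAbove x l) 0 u ∧
      (x ∈ (unmarked ρ.rhs).varFinset → τ' x = BottomUp.raise (nextMark .hole l x) u) := by
    intro x
    by_cases hx : x ∈ (unmarked ρ.rhs).varFinset
    · obtain ⟨htr, hfit⟩ := (hτ' x hx).frozen_inv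
        ((Nat.le_add_left 1 _).trans (le_rootMark_raise (nextMark .hole l x) (σ x)))
      obtain ⟨u, hu, hu'⟩ := htr.of_raise
      rw [hu, nextMark_hole] at hfit
      exact ⟨u, hu', .next _ _ _ (hmark x hx) (hfit.of_raise le_rfl (by omega)), fun _ => hu⟩
    · obtain ⟨q, hq⟩ := hA (erase (σ x))
      exact ⟨.var q, .leaf _ _ hq, .leaf _ _ _, fun h => (hx h).elim⟩
  choose τ hτ hfit hraise using hex
  have htrunc : Trunc A (l.subst σ) (l.subst τ) := .subst fun x _ => hτ x
  have hlfit : Fit k d 0 d (l.subst τ) := Fit.subst (by rw [← height_erase, hl]; exact hd ρ hρ)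
    fun x _ => by rw [Nat.zero_max]; exact hfit x
  have hlmark := htrunc.maxMark_le hs
  obtain ⟨v, hv, hstar⟩ := Adm.exists_star_of_fit (R := R) (H := d + k * d + 1) (by omega)
    htrunc hlfit
  refine ⟨v, hv, hstar.tail (.root ?_)⟩
  rw [subst_congr hraise]
  exact .rewrite ρ hρ l τ hl h0 (fun x hx => hmark x (by rwa [varFinset_unmarked])) _ rfl
    ⟨(hlfit.height_le (Nat.zero_le _) hlmark).trans (by rw [Nat.sub_zero]; omega), hlmark⟩

theorem Adm.exists_star_of_derivation (hA : ∀ t, (A.states t).Nonempty) (hR : LinearSystem R)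
    (hd : ∀ ρ ∈ R, height ρ.lhs ≤ d) {s t : (marked L).Term Empty}
    (h : ReflTransGen (BUStep R k) s t) (hs : Increasing s) {q : Q}
    (hq : q ∈ A.states (erase t)) :
    ∃ v, Adm A k d s v ∧
      ReflTransGen (NullCongr (TruncStep R A k (d + k * d + 1))) v (.var q) := by
  induction h using ReflTransGen.head_induction_on with
  | refl => exact Adm.exists_star_var (by omega) hq
  | head hst _ ih =>
    obtain ⟨w, hw, hwq⟩ := ih (hst.increasing hs)
    obtain ⟨hs', ht', ρ, hρ, C, l, ⟨hl, σ, rfl, rfl⟩, hwb⟩ := hst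
    obtain ⟨hC, h0⟩ := hwb.markAbove_eq_zero hl hs
    have hmark : nextMark C l = nextMark .hole l := by
      funext x
      simp [nextMark, hC, Ctx.markAbove]
    simp only [hmark] at hw ht'
    obtain ⟨v, hv, hvw⟩ := Adm.fill hC (fun w hw => Adm.exists_star_of_root_step hA hR hd hρ hl h0
      (maxMark_le_of_fill hs') (maxMark_le_of_fill ht') hw) hw
    exact ⟨v, hv, hvw.trans hwq⟩

end BottomUp

open BottomUp in
theorem mainTheorem1 (L : FirstOrder.Language.{u, v}) [Finite (Σ n, L.Functions n)]
    (R : Set (BottomUp.Rule L)) (hfin : R.Finite) (hlin : BottomUp.LinearSystem R)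
    (T : Set (L.Term Empty)) (hT : BottomUp.Recognizable T) (k : ℕ) :
    BottomUp.Recognizable (BottomUp.buAncestors R k T) := by
  obtain ⟨Q, _, A, rfl, hA⟩ := hT.exists_complete
  obtain ⟨d, hd⟩ : ∃ d, ∀ ρ ∈ R, height ρ.lhs ≤ d := by
    obtain ⟨d, hd⟩ := (hfin.image fun ρ : Rule L => height ρ.lhs).bddAbove
    exact ⟨d, fun ρ hρ => hd ⟨ρ, hρ, rfl⟩⟩
  have hrec := recognizable_of_finite_redexes (S := TruncStep R A k (d + k * d + 1))
    (finite_boundedTerms (L := L) (α := Q) (d + k * d + 1) k) (fun _ _ h => h.mem)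
    (fun _ _ h => arg_mem_boundedTerms h) (F := FirstOrder.Language.Term.var '' A.final)
    (by rintro _ ⟨q, _, rfl⟩; exact ⟨Nat.zero_le _, Nat.zero_le _⟩)
  convert hrec using 1
  ext s
  constructor
  · rintro ⟨_, ⟨q, hq, hqt⟩, t, hst, rfl⟩
    obtain ⟨v, hv, hvq⟩ := Adm.exists_star_of_derivation hA hlin hd hst (increasing_unmarked s) hqt
    exact ⟨_, ⟨q, hq, rfl⟩, hv.eq_embed ▸ hvq⟩
  · rintro ⟨_, ⟨q, hq, rfl⟩, h⟩
    obtain ⟨t, hst, ht⟩ := (Trunc.embed s).lift_star hlin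
      ((maxMark_unmarked s).trans_le (Nat.zero_le k)) h
    cases ht with
    | leaf _ _ hqt => exact ⟨_, ⟨q, hq, hqt⟩, t, hst, rfl⟩
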